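/- Let $A$ be a finite totally ordered alphabet. A column is a finite subset of $A$, also viewed as a strictly decreasing word; the empty column is the empty word. Column insertion of a letter $x$ into a column $\gamma$ gives the column $x\cdot\gamma$ defined as follows: if every letter of $\gamma$ is $<x$, then $x\cdot\gamma=\gamma\cup\{x\}$ and no letter is bumped; otherwise, with $y$ the smallest letter of $\gamma$ such that $y\ge x$, one has $x\cdot\gamma=(\gamma\setminus\{y\})\cup\{x\}$ and $y$ is bumped. For a word $w=a_1\cdots a_n$ put $w\cdot\gamma=a_1\cdot(a_2\cdot(\cdots(a_n\cdot\gamma)))$. A letter is column-inserted into a semistandard tableau (given by its columns, from left to right) by inserting it into the first column, then the bumped letter, if any, into the second column, and so on; $P(w)$ is the tableau obtained from the empty tableau by inserting $a_n$, then $a_{n-1}$, ..., then $a_1$. For columns write $\gamma\le\delta$ if $|\delta|\le|\gamma|$ and, for each $i\le|\delta|$, the $i$-th smallest letter of $\gamma$ is $\le$ the $i$-th smallest letter of $\delta$ (for nonempty columns: $\gamma,\delta$ are the columns, from left to right, of a semistandard tableau). For columns $\gamma,\delta$ let $\gamma'=\gamma\cdot\delta$ (the decreasing word $\gamma$ acting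 on $\delta$) and $\delta'=(\gamma\cup\delta)\setminus\gamma'$, computed as multisets (with $\cup$ the sum of multiplicities); $\delta'$ is a possibly empty column. Let $\mathcal C$ be the set of nonempty columns. The relation $u\equiv v\iff P(u)=P(v)$ is a congruence of the free monoid $A^*$; its quotient is the plactic monoid. Moreover: (i) The plactic monoid has the following presentation: it is generated by the columns $\gamma\in\mathcal C$ (each $\gamma$ standing for the class of its decreasing word), subject to the relations $\gamma\delta=\gamma'\delta'$ for all $\gamma,\delta\in\mathcal C$, with $\delta'$ omitted if it is empty. (ii) The rewriting system on the free monoid $\mathcal C^*$ given by the rules $\gamma\delta\to\gamma'\delta'$ for all $\gamma,\delta\in\mathcal C$ with $\gamma\not\le\delta$ (again with $\delta'$ omitted if it is empty) is confluent, in the following sense: the words that have no left-hand side of a rule as a factor form a set of representatives of the congruence of $\mathcal C^*$ generated by the rewriting relation, that is, by the least reflexive and transitive relation on $\mathcal C^*$ that contains the rules and is compatible with left and right multiplication. -/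

import Mathlib

namespace Plactic

variable {A : Type*} [LinearOrder A]

/-! Columns over the totally ordered alphabet `A` are viewed as finite subsets of `A`;
a tableau is recorded as the list of its nonempty columns, from left to right. -/

/-- The letters of the column `γ` that are `≥ x`. -/
def above (x : A) (γ : Finset A) : Finset A := γ.filter fun y => x ≤ y

/-- The letter bumped when `x` is inserted into the column `γ`: the smallest `y ∈ γ` with `x ≤ y`,
and `none` if every letter of `γ` is `< x`. -/
def bumped (x : A) (γ : Finset A) : Option A :=
  if h : (above x γ).Nonempty then some ((above x γ).min' h) else none

/-- Column insertion of the letter `x` into the column `γ`, that is, the action `x · γ`. -/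
def insertLetter (x : A) (γ : Finset A) : Finset A :=
  match bumped x γ with
  | none => insert x γ
  | some y => insert x (γ.erase y)

/-- Column insertion of a letter into a tableau: insert it into the first column, and insert the
bumped letter, if there is one, into the tableau formed by the remaining columns. -/
def insertTableau : A → List (Finset A) → List (Finset A)
  | x, [] => [{x}]
  | x, γ :: T =>
    match bumped x γ with
    | none => insertLetter x γ :: T
    | some y => insertLetter x γ :: insertTableau y T

/-- The tableau `P(w)`: column insertion of the word `w` into the empty tableau, starting with
the last letter of `w`. -/
def P (w : FreeMonoid A) : List (Finset A) :=
  w.toList.foldr insertTableau []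

/-- The left action `w · γ` of words on columns. -/
def act (w : FreeMonoid A) (γ : Finset A) : Finset A :=
  w.toList.foldr insertLetter γ

/-- The strictly decreasing word whose set of letters is the column `γ`. -/
def word (γ : Finset A) : FreeMonoid A := FreeMonoid.ofList (γ.sort (· ≥ ·))

/-- The order on columns. `γ ≤ δ` when `γ` is at least as high as `δ` and, at each height of `δ`,
the letter of `γ` is at most the letter of `δ`; for nonempty columns this says that `γ`, `δ` are the
columns, from left to right, of a tableau. -/
def ColumnLE (γ δ : Finset A) : Prop :=
  ∃ h : δ.card ≤ γ.card, ∀ i : Fin δ.card,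
    γ.orderEmbOfFin rfl (Fin.castLE h i) ≤ δ.orderEmbOfFin rfl i

theorem mem_insertLetter (x : A) (γ : Finset A) : x ∈ insertLetter x γ := by
  unfold insertLetter
  split <;> simp

theorem mem_insertLetter_of_lt {x z : A} {γ : Finset A} (hz : z ∈ γ) (hzx : z < x) :
    z ∈ insertLetter x γ := by
  unfold insertLetter
  split
  · simp [hz]
  · rename_i y hy
    have hxy : x ≤ y := by
      unfold bumped at hy
      split at hy
      · rename_i h
        have := Finset.min'_mem _ h
        rw [Option.some.inj hy] at this
        exact (Finset.mem_filter.1 this).2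
      · simp at hy
    simp [hz, (lt_of_lt_of_le hzx hxy).ne]

theorem subset_foldr (l : List A) (hl : l.Pairwise (· > ·)) (δ : Finset A) :
    ∀ x ∈ l, x ∈ l.foldr insertLetter δ := by
  induction l with
  | nil => simp
  | cons a l ih =>
    rw [List.pairwise_cons] at hl
    intro x hx
    rcases List.mem_cons.1 hx with rfl | hx
    · exact mem_insertLetter _ _
    · exact mem_insertLetter_of_lt (ih hl.2 x hx) (hl.1 x hx)

theorem subset_act_word (γ δ : Finset A) : γ ⊆ act (word γ) δ := by
  intro x hx
  exact subset_foldr (γ.sort (· ≥ ·)) (γ.sortedGT_sort).pairwise δ x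
    ((Finset.mem_sort _).2 hx)

theorem nodup_rest (γ δ : Finset A) : (γ.val + δ.val - (act (word γ) δ).val).Nodup := by
  refine Multiset.nodup_of_le (s := γ.val + δ.val - (act (word γ) δ).val) (t := δ.val) ?_ δ.nodup
  rw [Multiset.sub_le_iff_le_add, add_comm]
  exact Multiset.add_le_add_left (Finset.val_le_iff.2 (subset_act_word γ δ))

/-- The column `δ' = (γ ∪ δ) ∖ (γ · δ)`, computed with multiplicities. It may be empty. -/
def rest (γ δ : Finset A) : Finset A :=
  ⟨γ.val + δ.val - (act (word γ) δ).val, nodup_rest γ δ⟩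

variable (A) in
/-- The generators: the nonempty columns (the empty column is the empty word). -/
abbrev Column : Type _ := {γ : Finset A // γ.Nonempty}

/-- The column `γ' = γ · δ`. -/
def top (γ δ : Column A) : Column A :=
  ⟨act (word γ.1) δ.1, γ.2.mono (subset_act_word γ.1 δ.1)⟩

/-- A possibly empty column as a word in the nonempty columns: the one-letter word `γ` if `γ` is
nonempty, the empty word otherwise. -/
def columnWord (γ : Finset A) : FreeMonoid (Column A) :=
  if h : γ.Nonempty then FreeMonoid.of ⟨γ, h⟩ else 1

variable (A) in
/-- The quadratic relations `γδ = γ'δ'`, for all columns `γ`, `δ`, with `δ'` omitted if empty. -/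
def quadraticRel (u v : FreeMonoid (Column A)) : Prop :=
  ∃ γ δ : Column A, u = FreeMonoid.of γ * FreeMonoid.of δ ∧
    v = FreeMonoid.of (top γ δ) * columnWord (rest γ.1 δ.1)

variable (A) in
/-- The rewriting rules `γδ → γ'δ'`, for the columns `γ`, `δ` with `γ ≰ δ`. -/
def quadraticRule (u v : FreeMonoid (Column A)) : Prop :=
  ∃ γ δ : Column A, ¬ ColumnLE γ.1 δ.1 ∧ u = FreeMonoid.of γ * FreeMonoid.of δ ∧
    v = FreeMonoid.of (top γ δ) * columnWord (rest γ.1 δ.1)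

variable (A) in
/-- The plactic congruence: the congruence of the free monoid generated by the relation
`P(u) = P(v)`. (This relation is itself a congruence, which is part of the theorem.) -/
def placticCon : Con (FreeMonoid A) := conGen fun u v => P u = P v

variable (A) in
/-- The plactic monoid. -/
abbrev PlacticMonoid : Type _ := (placticCon A).Quotient

end Plactic

namespace Rewriting

variable {C : Type*}

/-- The rewriting system on the free monoid generated by the rules `R`: the least reflexive and
transitive relation that contains `R` and is compatible with left and right multiplication. -/
inductive RewritesTo (R : FreeMonoid C → FreeMonoid C → Prop) :
    FreeMonoid C → FreeMonoid C → Prop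
  | rule {u v} : R u v → RewritesTo R u v
  | refl (u) : RewritesTo R u u
  | trans {u v w} : RewritesTo R u v → RewritesTo R v w → RewritesTo R u w
  | mul_left (x) {u v} : RewritesTo R u v → RewritesTo R (x * u) (x * v)
  | mul_right (x) {u v} : RewritesTo R u v → RewritesTo R (u * x) (v * x)

/-- The word `w` may not be rewritten: no left-hand side of a rule is a factor of `w`. -/
def IsReduced (R : FreeMonoid C → FreeMonoid C → Prop) (w : FreeMonoid C) : Prop :=
  ∀ x u y v, R u v → w ≠ x * u * y

/-- The rewriting system generated by `R` is confluent: the words that may not be rewritten form a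
set of representatives of the congruence generated by the rewriting relation. -/
def IsConfluent (R : FreeMonoid C → FreeMonoid C → Prop) : Prop :=
  ∀ w, ∃! v, IsReduced R v ∧ conGen (RewritesTo R) w v

end Rewriting

namespace Plactic

variable {A : Type*} [LinearOrder A]

/-! The plactic congruence is shown to be the congruence generated by the Knuth relations
(`knuthCon_iff`). In one direction, inserting the two sides of a Knuth relation into a column gives
the same column, and the two words of bumped letters are equal or again form a Knuth relation
(`KnuthRel.act_bumpedWord`); induction along the columns shows that `P` is invariant. In the other
direction, each bump is realised by Knuth relations, so every word is congruent to the column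
reading of its tableau (`knuthCon_reading_P`).

For columns, the letters bumped while `γ` acts on `δ` form a decreasing word, namely that of `δ'`
(`word_rest`), so the quadratic relations hold in the plactic monoid. Conversely, they imply the
Knuth relations and write each column as the product of its letters (`letterHom_eq_of_knuthRel`,
`letterHom_word`). This gives (i).

For (ii), the rules left out are trivial, because `γ' = γ` and `δ' = δ` when `γ ≤ δ`. Reduced words
are therefore the tableaux. Every class contains one because `P w` is a tableau (`isChain_P`), and
only one because `P` recovers a tableau from its reading (`P_reading`). No termination argument is
needed. -/

/-! ### Insertion of one letter into a column. -/

theorem bumped_eq_some {x y : A} {γ : Finset A} :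
    bumped x γ = some y ↔ y ∈ γ ∧ x ≤ y ∧ ∀ z ∈ γ, x ≤ z → y ≤ z := by
  unfold bumped
  split
  · rename_i h
    have h1 := Finset.min'_mem _ h
    have h2 := fun z hz => Finset.min'_le (above x γ) z hz
    simp only [above, Finset.mem_filter] at h1 h2
    rw [Option.some.injEq]
    constructor
    · rintro rfl
      exact ⟨h1.1, h1.2, fun z hz hxz => h2 z ⟨hz, hxz⟩⟩
    · rintro ⟨hy, hxy, hmin⟩
      exact le_antisymm (h2 y ⟨hy, hxy⟩) (hmin _ h1.1 h1.2)
  · rename_i h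
    simp only [reduceCtorEq, false_iff]
    rintro ⟨hy, hxy, -⟩
    exact h ⟨y, by simp [above, hy, hxy]⟩

theorem bumped_eq_none {x : A} {γ : Finset A} : bumped x γ = none ↔ ∀ z ∈ γ, z < x := by
  unfold bumped
  split
  · rename_i h
    obtain ⟨z, hz⟩ := h
    simp only [above, Finset.mem_filter] at hz
    simp only [reduceCtorEq, false_iff]
    exact fun h => absurd (h z hz.1) (not_lt.2 hz.2)
  · rename_i h
    simpa [above, Finset.filter_eq_empty_iff] using h

theorem mem_insertLetter_iff {x z : A} {γ : Finset A} :
    z ∈ insertLetter x γ ↔ z = x ∨ (z ∈ γ ∧ bumped x γ ≠ some z) := by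
  unfold insertLetter
  split <;> rename_i h <;> grind

theorem insertLetter_of_none {x : A} {γ : Finset A} (h : bumped x γ = none) :
    insertLetter x γ = insert x γ := by simp [insertLetter, h]

theorem insertLetter_of_some {x y : A} {γ : Finset A} (h : bumped x γ = some y) :
    insertLetter x γ = insert x (γ.erase y) := by simp [insertLetter, h]

theorem bumped_congr {x : A} {γ δ : Finset A} (h : ∀ z, x ≤ z → (z ∈ γ ↔ z ∈ δ)) :
    bumped x γ = bumped x δ := by
  have : above x γ = above x δ := by
    ext z
    simp only [above, Finset.mem_filter]
    exact ⟨fun hz => ⟨(h z hz.2).1 hz.1, hz.2⟩, fun hz => ⟨(h z hz.2).2 hz.1, hz.2⟩⟩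
  unfold bumped
  simp only [this]

/-! ### Insertion of words: the resulting column and the bumped letters. -/

/-- The word formed by an optional letter. -/
def optWord (o : Option A) : FreeMonoid A := o.elim 1 FreeMonoid.of

@[simp] theorem optWord_none : optWord (none : Option A) = 1 := rfl
@[simp] theorem optWord_some (a : A) : optWord (some a) = FreeMonoid.of a := rfl

/-- The word of the letters bumped when a word is inserted into a column. -/
def bumpedWord (w : FreeMonoid A) (γ : Finset A) : FreeMonoid A :=
  FreeMonoid.recOn w 1 fun a l r => optWord (bumped a (act l γ)) * r

@[simp] theorem act_one (γ : Finset A) : act 1 γ = γ := rfl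

@[simp] theorem act_of (x : A) (γ : Finset A) : act (FreeMonoid.of x) γ = insertLetter x γ := rfl

theorem act_mul (u v : FreeMonoid A) (γ : Finset A) : act (u * v) γ = act u (act v γ) := by
  simp [act]

@[simp] theorem bumpedWord_one (γ : Finset A) : bumpedWord 1 γ = 1 := rfl

theorem bumpedWord_of_mul (x : A) (u : FreeMonoid A) (γ : Finset A) :
    bumpedWord (FreeMonoid.of x * u) γ = optWord (bumped x (act u γ)) * bumpedWord u γ := rfl

@[simp] theorem bumpedWord_of (x : A) (γ : Finset A) :
    bumpedWord (FreeMonoid.of x) γ = optWord (bumped x γ) := by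
  simpa using bumpedWord_of_mul x 1 γ

theorem bumpedWord_mul (u v : FreeMonoid A) (γ : Finset A) :
    bumpedWord (u * v) γ = bumpedWord u (act v γ) * bumpedWord v γ := by
  induction u using FreeMonoid.inductionOn' with
  | one => simp
  | of_mul x u ih => rw [mul_assoc, bumpedWord_of_mul, bumpedWord_of_mul, ih, act_mul, mul_assoc]

/-- Column insertion of a word into a tableau. -/
def insertWord (w : FreeMonoid A) (T : List (Finset A)) : List (Finset A) :=
  w.toList.foldr insertTableau T

@[simp] theorem insertWord_one (T : List (Finset A)) : insertWord 1 T = T := rfl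

@[simp] theorem insertWord_of (x : A) (T : List (Finset A)) :
    insertWord (FreeMonoid.of x) T = insertTableau x T := rfl

theorem insertWord_mul (u v : FreeMonoid A) (T : List (Finset A)) :
    insertWord (u * v) T = insertWord u (insertWord v T) := by
  simp [insertWord]

theorem P_eq_insertWord (w : FreeMonoid A) : P w = insertWord w [] := rfl

theorem insertTableau_cons (x : A) (γ : Finset A) (T : List (Finset A)) :
    insertTableau x (γ :: T) = insertLetter x γ :: insertWord (optWord (bumped x γ)) T := by
  rw [insertTableau]
  split <;> rename_i h <;> simp [h]

/-- Lets the end of a tableau be treated as an empty column, but only for nonempty words: the empty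
word would leave `[]` and `[∅]` distinct. -/
theorem insertTableau_nil (x : A) : insertTableau x [] = insertTableau x [∅] := by
  have h : bumped x ∅ = none := bumped_eq_none.2 (by simp)
  rw [insertTableau_cons, insertLetter_of_none h, h]
  simp [insertTableau]

/-- Later columns see `w` only through its bumped letters, in order. This reduces statements about
tableaux to statements about one column. -/
theorem insertWord_cons (w : FreeMonoid A) (γ : Finset A) (T : List (Finset A)) :
    insertWord w (γ :: T) = act w γ :: insertWord (bumpedWord w γ) T := by
  induction w using FreeMonoid.inductionOn' with
  | one => simp
  | of_mul x u ih =>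
    rw [insertWord_mul, ih, insertWord_of, insertTableau_cons, act_mul, act_of, bumpedWord_of_mul,
      insertWord_mul]

theorem insertWord_mul_of_nil (w : FreeMonoid A) (x : A) :
    insertWord (w * FreeMonoid.of x) [] = insertWord (w * FreeMonoid.of x) [∅] := by
  rw [insertWord_mul, insertWord_mul, insertWord_of, insertWord_of, insertTableau_nil]

/-! ### Invariance of insertion under the Knuth relations. -/

/-- The Knuth relations. -/
inductive KnuthRel : FreeMonoid A → FreeMonoid A → Prop
  | left {x y z : A} (hxy : x ≤ y) (hyz : y < z) :
      KnuthRel (.of x * .of z * .of y) (.of z * .of x * .of y)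
  | right {x y z : A} (hxy : x < y) (hyz : y ≤ z) :
      KnuthRel (.of y * .of x * .of z) (.of y * .of z * .of x)

variable (A) in
/-- The congruence generated by the Knuth relations. -/
def knuthCon : Con (FreeMonoid A) := conGen KnuthRel

theorem bumped_insertLetter_of_lt {x z : A} {γ : Finset A} (hxz : x < z)
    (h : ∀ y, bumped x γ = some y → y < z) : bumped z (insertLetter x γ) = bumped z γ := by
  apply bumped_congr
  intro t ht
  rw [mem_insertLetter_iff]
  grind

theorem bumped_insertLetter_of_bumped_lt {x x' z : A} {γ : Finset A}
    (h : bumped x γ = some x') (hz : x' < z) : bumped x (insertLetter z γ) = some x' := by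
  rw [bumped_eq_some] at h ⊢
  simp only [mem_insertLetter_iff]
  have := @bumped_eq_some _ _ z x' γ
  grind

theorem insertLetter_comm {x x' z : A} {γ : Finset A} (h : bumped x γ = some x') (hz : x' < z) :
    insertLetter x (insertLetter z γ) = insertLetter z (insertLetter x γ) := by
  have hx := (bumped_eq_some.1 h).2.1
  have h1 := bumped_insertLetter_of_bumped_lt h hz
  have h2 := bumped_insertLetter_of_lt (hx.trans_lt hz) (by grind : ∀ y, bumped x γ = some y → y < z)
  have h3 : ∀ t, bumped z γ = some t → z ≤ t := fun t ht => (bumped_eq_some.1 ht).2.1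
  ext t
  simp only [mem_insertLetter_iff, h1, h2, h]
  grind

theorem bumped_le {x y : A} {γ : Finset A} (hy : y ∈ γ) (hxy : x ≤ y) :
    ∃ z, bumped x γ = some z ∧ x ≤ z ∧ z ≤ y := by
  cases h : bumped x γ with
  | none => exact absurd (bumped_eq_none.1 h y hy) (not_lt.2 hxy)
  | some z =>
    rw [bumped_eq_some] at h
    exact ⟨z, rfl, h.2.1, h.2.2 y hy hxy⟩

/-- Once `y` is in the column, `x` bumps some `x' ≤ y < z`, so the insertions of `x` and `z` do not
interfere. If `z` bumps `z'`, then `y` bumps some `y'` with `x' ≤ y' < z'`, strictly since `y'` has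
left the column. -/
theorem KnuthRel.act_bumpedWord_left {x y z : A} (hxy : x ≤ y) (hyz : y < z) (γ : Finset A) :
    act (.of x * .of z * .of y) γ = act (.of z * .of x * .of y) γ ∧
      (bumpedWord (.of x * .of z * .of y) γ = bumpedWord (.of z * .of x * .of y) γ ∨
        KnuthRel (bumpedWord (.of x * .of z * .of y) γ)
          (bumpedWord (.of z * .of x * .of y) γ)) := by
  simp only [act_mul, bumpedWord_mul, act_of, bumpedWord_of]
  obtain ⟨x', hx', -, hx'y⟩ := bumped_le (mem_insertLetter y γ) hxy
  refine ⟨insertLetter_comm hx' (hx'y.trans_lt hyz), ?_⟩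
  have hz : bumped z (insertLetter x (insertLetter y γ)) = bumped z (insertLetter y γ) :=
    bumped_insertLetter_of_lt (hxy.trans_lt hyz) (by grind)
  rw [hz, bumped_insertLetter_of_bumped_lt hx' (hx'y.trans_lt hyz), hx']
  cases h : bumped z (insertLetter y γ) with
  | none => left; simp
  | some z' =>
    obtain ⟨hz1, hz2, -⟩ := bumped_eq_some.1 h
    rw [mem_insertLetter_iff] at hz1
    have hz3 : z' ∈ γ := by grind
    obtain ⟨y', hy', hy1, hy2⟩ := bumped_le hz3 (hyz.le.trans hz2)
    right
    simp only [hy', optWord_some]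
    exact .left (hx'y.trans hy1) (by grind)

theorem KnuthRel.act_bumpedWord_right {x y z : A} (hxy : x < y) (hyz : y ≤ z) (γ : Finset A) :
    act (.of y * .of x * .of z) γ = act (.of y * .of z * .of x) γ ∧
      (bumpedWord (.of y * .of x * .of z) γ = bumpedWord (.of y * .of z * .of x) γ ∨
        KnuthRel (bumpedWord (.of y * .of x * .of z) γ)
          (bumpedWord (.of y * .of z * .of x) γ) ∨
        KnuthRel (bumpedWord (.of y * .of z * .of x) γ)
          (bumpedWord (.of y * .of x * .of z) γ)) := by
  simp only [act_mul, bumpedWord_mul, act_of, bumpedWord_of]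
  have hxz := hxy.trans_le hyz
  -- If `x` bumps a letter below `z`, the insertions of `x` and `z` commute and the bumped letters
  -- satisfy the same relation.
  by_cases hlt : ∃ x', bumped x γ = some x' ∧ x' < z
  · obtain ⟨x', hx', hx'z⟩ := hlt
    have hc := insertLetter_comm hx' hx'z
    refine ⟨by rw [hc], ?_⟩
    have hz : bumped z (insertLetter x γ) = bumped z γ :=
      bumped_insertLetter_of_lt hxz (by grind)
    rw [hc, hz, bumped_insertLetter_of_bumped_lt hx' hx'z, hx']
    cases h : bumped z γ with
    | none => left; simp
    | some z' =>
      obtain ⟨hz1, hz2, -⟩ := bumped_eq_some.1 h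
      obtain ⟨y', hy', hy1, hy2⟩ := bumped_le (mem_insertLetter z (insertLetter x γ)) hyz
      right; left
      simp only [hy', optWord_some]
      have hm := (bumped_eq_some.1 hy').1
      rw [mem_insertLetter_iff, mem_insertLetter_iff] at hm
      have hm' := bumped_eq_some.1 hx'
      refine .right ?_ (hy2.trans hz2)
      rcases hm with rfl | ⟨rfl | ⟨hm, hm2⟩, -⟩
      · exact hx'z
      · exact absurd hxy (not_lt.2 hy1)
      · exact lt_of_le_of_ne (hm'.2.2 _ hm (hxy.le.trans hy1)) (by grind)
  -- Now no letter of `γ` lies in `[x, z)`, so `x` and `z` would bump the same `m`. With `n` the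
  -- letter that `z` bumps after `x`, the bumped words are `n z m` and `z n m`, where `z ≤ m < n`:
  -- the other Knuth relation, with its sides exchanged.
  · have hge : ∀ t ∈ γ, x ≤ t → z ≤ t := by
      intro t ht hxt
      obtain ⟨x', hx', -, h2⟩ := bumped_le ht hxt
      exact (not_lt.1 fun h => hlt ⟨x', hx', h⟩).trans h2
    have hzx : bumped z γ = bumped x γ := by
      cases h : bumped x γ with
      | none => exact bumped_eq_none.2 fun t ht => (bumped_eq_none.1 h t ht).trans hxz
      | some m =>
        obtain ⟨h1, h2, h3⟩ := bumped_eq_some.1 h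
        exact bumped_eq_some.2 ⟨h1, hge m h1 h2, fun t ht hzt => h3 t ht (hxz.le.trans hzt)⟩
    have hx1 : bumped x (insertLetter z γ) = some z := by
      rw [bumped_eq_some]
      refine ⟨mem_insertLetter _ _, hxz.le, fun t ht hxt => ?_⟩
      rw [mem_insertLetter_iff] at ht
      grind
    have hy1 : bumped y (insertLetter z (insertLetter x γ)) = some z := by
      rw [bumped_eq_some]
      refine ⟨mem_insertLetter _ _, hyz, fun t ht hxt => ?_⟩
      simp only [mem_insertLetter_iff] at ht
      grind
    have hzz : z ∈ γ → bumped x γ = some z := fun h => bumped_eq_some.2 ⟨h, hxz.le, hge⟩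
    have hEq : insertLetter x (insertLetter z γ) = insertLetter x γ := by
      ext t
      simp only [mem_insertLetter_iff, hx1, hzx]
      grind
    have hy2 : bumped y (insertLetter x (insertLetter z γ)) = bumped z (insertLetter x γ) := by
      rw [hEq]
      have hgap : ∀ t ∈ insertLetter x γ, y ≤ t → z ≤ t := by
        intro t ht
        rw [mem_insertLetter_iff] at ht
        grind
      cases h : bumped z (insertLetter x γ) with
      | none =>
        rw [bumped_eq_none] at h ⊢
        grind
      | some m =>
        rw [bumped_eq_some] at h ⊢
        grind
    rw [hEq]
    rw [hEq] at hy2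
    have hn : ∀ n, bumped z (insertLetter x γ) = some n →
        ∃ m, bumped x γ = some m ∧ z ≤ m ∧ m < n := by
      intro n hn
      obtain ⟨h1, h2, -⟩ := bumped_eq_some.1 hn
      rw [mem_insertLetter_iff] at h1
      have h3 : n ∈ γ := by grind
      obtain ⟨m, hm, h4, h5⟩ := bumped_le h3 (hxz.le.trans h2)
      exact ⟨m, hm, hge m (bumped_eq_some.1 hm).1 h4, by grind⟩
    constructor
    · ext t
      simp only [mem_insertLetter_iff, hy1, hy2]
      grind
    · rw [hx1, hy1, hy2, hzx]
      cases h : bumped z (insertLetter x γ) with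
      | none => left; simp
      | some n =>
        obtain ⟨m, hm, h1, h2⟩ := hn n h
        right; right
        simp only [hm, optWord_some]
        exact .left h1 h2

theorem KnuthRel.act_bumpedWord {u v : FreeMonoid A} (h : KnuthRel u v) (γ : Finset A) :
    act u γ = act v γ ∧ (bumpedWord u γ = bumpedWord v γ ∨
      KnuthRel (bumpedWord u γ) (bumpedWord v γ) ∨
        KnuthRel (bumpedWord v γ) (bumpedWord u γ)) := by
  cases h with
  | left hxy hyz =>
    obtain ⟨h1, h2⟩ := act_bumpedWord_left hxy hyz γ
    exact ⟨h1, h2.imp_right Or.inl⟩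
  | right hxy hyz => exact act_bumpedWord_right hxy hyz γ

theorem KnuthRel.length_left {u v : FreeMonoid A} (h : KnuthRel u v) : u.length = 3 := by
  cases h <;> rfl

theorem length_bumpedWord_le (u : FreeMonoid A) (γ : Finset A) :
    (bumpedWord u γ).length ≤ u.length := by
  induction u using FreeMonoid.inductionOn' with
  | one => simp
  | of_mul x u ih =>
    rw [bumpedWord_of_mul, FreeMonoid.length_mul, FreeMonoid.length_mul]
    refine add_le_add ?_ ih
    cases bumped x (act u γ) <;> simp

theorem length_bumpedWord_mul_of_empty (u : FreeMonoid A) (x : A) :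
    (bumpedWord (u * .of x) ∅).length ≤ u.length := by
  have h : bumped x ∅ = none := bumped_eq_none.2 (by simp)
  rw [bumpedWord_mul, bumpedWord_of, h, optWord_none, mul_one]
  exact length_bumpedWord_le u _

theorem KnuthRel.exists_mul_of {u v : FreeMonoid A} (h : KnuthRel u v) :
    ∃ u' v' x y, u = u' * .of x ∧ v = v' * .of y ∧ u'.length = 2 ∧ v'.length = 2 := by
  cases h <;> exact ⟨_, _, _, _, rfl, rfl, rfl, rfl⟩

theorem KnuthRel.insertWord_eq {u v : FreeMonoid A} (h : KnuthRel u v) (T : List (Finset A)) :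
    insertWord u T = insertWord v T := by
  induction T generalizing u v with
  | nil =>
    obtain ⟨u', v', x, y, rfl, rfl, hu, hv⟩ := h.exists_mul_of
    -- The first letter inserted into an empty column bumps nothing, so the bumped words are too
    -- short to form a Knuth relation and must be equal.
    have h1 := length_bumpedWord_mul_of_empty u' x
    have h2 := length_bumpedWord_mul_of_empty v' y
    rw [insertWord_mul_of_nil, insertWord_mul_of_nil, insertWord_cons, insertWord_cons]
    obtain ⟨h3, h4 | h4 | h4⟩ := h.act_bumpedWord ∅
    · rw [h3, h4]
    · have := h4.length_left
      omega
    · have := h4.length_left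
      omega
  | cons γ T ih =>
    rw [insertWord_cons, insertWord_cons]
    obtain ⟨h1, h2 | h2 | h2⟩ := h.act_bumpedWord γ
    · rw [h1, h2]
    · rw [h1, ih h2]
    · rw [h1, ih h2]

theorem insertWord_eq_of_knuthCon {u v : FreeMonoid A} (h : knuthCon A u v)
    (T : List (Finset A)) : insertWord u T = insertWord v T := by
  replace h : ConGen.Rel KnuthRel u v := h
  induction h generalizing T with
  | of _ _ h => exact h.insertWord_eq T
  | refl => rfl
  | symm _ ih => exact (ih T).symm
  | trans _ _ ih1 ih2 => exact (ih1 T).trans (ih2 T)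
  | mul _ _ ih1 ih2 =>
    rw [insertWord_mul, insertWord_mul, ih1, ih2]

/-! ### Every word is Knuth congruent to the reading of its tableau. -/

/-- A strictly decreasing list is the word of its set of letters. -/
theorem word_eq_ofList {γ : Finset A} {l : List A} (hl : l.Pairwise (· > ·))
    (h : ∀ x, x ∈ l ↔ x ∈ γ) : word γ = FreeMonoid.ofList l := by
  unfold word
  congr 1
  refine List.Perm.eq_of_pairwise (le := (· > ·))
    (fun a b _ _ h1 h2 => absurd h1 (not_lt.2 h2.le)) (γ.sortedGT_sort).pairwise hl ?_
  rw [List.perm_ext_iff_of_nodup (γ.sort_nodup _) (hl.imp fun h => h.ne')]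
  simp [h]

theorem pairwise_toList_word (γ : Finset A) : (word γ).toList.Pairwise (· > ·) :=
  (γ.sortedGT_sort).pairwise

@[simp] theorem mem_toList_word {x : A} {γ : Finset A} : x ∈ (word γ).toList ↔ x ∈ γ := by
  simp [word]

@[simp] theorem word_empty : word (∅ : Finset A) = 1 :=
  word_eq_ofList (l := []) (by simp) (by simp)

@[simp] theorem word_singleton (x : A) : word {x} = .of x :=
  word_eq_ofList (l := [x]) (by simp) (by simp)

theorem word_union {γ δ : Finset A} (h : ∀ x ∈ γ, ∀ y ∈ δ, y < x) :
    word (γ ∪ δ) = word γ * word δ := by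
  refine word_eq_ofList (l := (word γ).toList ++ (word δ).toList) ?_ (by simp)
  rw [List.pairwise_append]
  exact ⟨pairwise_toList_word γ, pairwise_toList_word δ, by simpa using h⟩

theorem word_insert {x : A} {γ : Finset A} (h : ∀ y ∈ γ, y < x) :
    word (insert x γ) = .of x * word γ := by
  rw [Finset.insert_eq, word_union (by simpa using h), word_singleton]

theorem knuthCon_of_rel {u v : FreeMonoid A} (h : KnuthRel u v) : knuthCon A u v :=
  ConGen.Rel.of _ _ h

/-- A letter commutes past the letters greater than `y` in a decreasing word ending in `y`. -/
theorem knuthCon_mul_decreasing {x y : A} (hxy : x ≤ y) (u : List A)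
    (hu : (u ++ [y]).Pairwise (· > ·)) :
    knuthCon A (.of x * .ofList (u ++ [y])) (.ofList u * (.of x * .of y)) := by
  induction u with
  | nil => exact (knuthCon A).refl _
  | cons a u ih =>
    rw [List.cons_append, List.pairwise_cons] at hu
    have ih := ih hu.2
    obtain ⟨b, t, hb⟩ : ∃ b t, u ++ [y] = b :: t := List.exists_cons_of_ne_nil (by simp)
    have hxb : x ≤ b := by
      have : y ∈ b :: t := by simp [← hb]
      rcases List.mem_cons.1 this with rfl | h
      · exact hxy
      · have h2 := hu.2
        rw [hb, List.pairwise_cons] at h2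
        exact hxy.trans (h2.1 y h).le
    have h1 : knuthCon A (.of x * .of a * .of b * .ofList t) (.of a * .of x * .of b * .ofList t) :=
      (knuthCon A).mul (knuthCon_of_rel (.left hxb (hu.1 b (by simp [hb])))) ((knuthCon A).refl _)
    have h2 := (knuthCon A).mul ((knuthCon A).refl (.of a)) ih
    rw [hb] at h2
    rw [List.cons_append, hb]
    simp only [FreeMonoid.ofList_cons, mul_assoc] at h1 h2 ⊢
    exact (knuthCon A).trans h1 h2

/-- A letter `y ≥ x` commutes past the letters less than `x` in a decreasing word starting with
`x`. -/
theorem knuthCon_decreasing_mul {x y : A} (hxy : x ≤ y) (v : List A)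
    (hv : (x :: v).Pairwise (· > ·)) :
    knuthCon A (.of x * .of y * .ofList v) (.of x * .ofList v * .of y) := by
  induction v generalizing x with
  | nil => exact (knuthCon A).refl _
  | cons c v ih =>
    rw [List.pairwise_cons] at hv
    have hcx : c < x := hv.1 c (by simp)
    have ih := ih (hcx.le.trans hxy) hv.2
    have h1 : knuthCon A (.of x * .of y * .of c * .ofList v) (.of x * .of c * .of y * .ofList v) :=
      (knuthCon A).symm <|
        (knuthCon A).mul (knuthCon_of_rel (.right hcx hxy)) ((knuthCon A).refl _)
    have h2 := (knuthCon A).mul ((knuthCon A).refl (.of x)) ih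
    simp only [FreeMonoid.ofList_cons, mul_assoc] at h1 h2 ⊢
    exact (knuthCon A).trans h1 h2

/-- If `y` is bumped, write `γ` as `U y V` with `U` above `y` and `V` below `x`. Then `x U y V ≡ U x
y V ≡ U x V y`. -/
theorem knuthCon_of_mul_word (x : A) (γ : Finset A) :
    knuthCon A (.of x * word γ) (word (insertLetter x γ) * optWord (bumped x γ)) := by
  cases h : bumped x γ with
  | none =>
    rw [insertLetter_of_none h, word_insert (bumped_eq_none.1 h), optWord_none, mul_one]
    exact (knuthCon A).refl _
  | some y =>
    obtain ⟨hy, hxy, hmin⟩ := bumped_eq_some.1 h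
    set U := γ.filter (y < ·) with hU
    set V := γ.filter (· < x) with hV
    have hUm : ∀ t ∈ U, y < t := by simp [hU]
    have hVm : ∀ t ∈ V, t < x := by simp [hV]
    have h1 : γ = U ∪ insert y V := by
      ext t
      simp only [hU, hV, Finset.mem_union, Finset.mem_insert, Finset.mem_filter]
      grind
    have h2 : insertLetter x γ = U ∪ insert x V := by
      ext t
      simp only [mem_insertLetter_iff, h, hU, hV, Finset.mem_union, Finset.mem_insert,
        Finset.mem_filter]
      grind
    have w1 : word γ = word U * (.of y * word V) := by
      rw [← word_insert fun t ht => (hVm t ht).trans_le hxy, ← word_union, ← h1]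
      grind
    have w2 : word (insertLetter x γ) = word U * (.of x * word V) := by
      rw [← word_insert hVm, ← word_union, ← h2]
      grind
    have k1 := knuthCon_mul_decreasing hxy (word U).toList (by
      rw [List.pairwise_append]
      exact ⟨pairwise_toList_word U, by simp, by simpa using hUm⟩)
    have k2 := knuthCon_decreasing_mul hxy (word V).toList (by
      rw [List.pairwise_cons]
      exact ⟨by simpa using hVm, pairwise_toList_word V⟩)
    have k3 := (knuthCon A).mul k1 ((knuthCon A).refl (word V))
    have k4 := (knuthCon A).mul ((knuthCon A).refl (word U)) k2
    rw [w1, w2, optWord_some]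
    simp only [FreeMonoid.ofList_append, FreeMonoid.ofList_toList, FreeMonoid.ofList_singleton,
      mul_assoc] at k3 k4 ⊢
    exact (knuthCon A).trans k3 k4

theorem knuthCon_mul_word (w : FreeMonoid A) (γ : Finset A) :
    knuthCon A (w * word γ) (word (act w γ) * bumpedWord w γ) := by
  induction w using FreeMonoid.inductionOn' with
  | one => simpa using (knuthCon A).refl _
  | of_mul x w ih =>
    have h1 := (knuthCon A).mul ((knuthCon A).refl (.of x)) ih
    have h2 := (knuthCon A).mul (knuthCon_of_mul_word x (act w γ))
      ((knuthCon A).refl (bumpedWord w γ))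
    rw [act_mul, act_of, bumpedWord_of_mul]
    simp only [mul_assoc] at h1 h2 ⊢
    exact (knuthCon A).trans h1 h2

/-- The column reading of a list of columns. -/
def reading (T : List (Finset A)) : FreeMonoid A := (T.map word).prod

theorem knuthCon_of_mul_reading (x : A) (T : List (Finset A)) :
    knuthCon A (.of x * reading T) (reading (insertTableau x T)) := by
  induction T generalizing x with
  | nil => simpa [reading, insertTableau] using (knuthCon A).refl _
  | cons γ T ih =>
    have h1 := (knuthCon A).mul (knuthCon_of_mul_word x γ) ((knuthCon A).refl (reading T))
    rw [insertTableau_cons]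
    cases h : bumped x γ with
    | none => simpa [h, reading, mul_assoc] using h1
    | some y =>
      have h2 := (knuthCon A).mul ((knuthCon A).refl (word (insertLetter x γ))) (ih y)
      simp only [h, reading, mul_assoc, optWord_some, insertWord_of, List.map_cons,
        List.prod_cons] at h1 h2 ⊢
      exact (knuthCon A).trans h1 h2

theorem knuthCon_reading_P (w : FreeMonoid A) : knuthCon A w (reading (P w)) := by
  induction w using FreeMonoid.inductionOn' with
  | one => exact (knuthCon A).refl _
  | of_mul x w ih =>
    have := (knuthCon A).mul ((knuthCon A).refl (.of x)) ih
    refine (knuthCon A).trans this ?_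
    rw [P_eq_insertWord (_ * _), insertWord_mul, insertWord_of, ← P_eq_insertWord]
    exact knuthCon_of_mul_reading x (P w)

theorem knuthCon_iff {u v : FreeMonoid A} : knuthCon A u v ↔ P u = P v := by
  refine ⟨fun h => insertWord_eq_of_knuthCon h [], fun h => ?_⟩
  have := knuthCon_reading_P u
  rw [h] at this
  exact (knuthCon A).trans this ((knuthCon A).symm (knuthCon_reading_P v))

variable (A) in
theorem placticCon_eq_knuthCon : placticCon A = knuthCon A := by
  apply le_antisymm
  · exact Con.conGen_le.2 fun u v h => knuthCon_iff.2 h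
  · exact fun u v h => ConGen.Rel.of _ _ (knuthCon_iff.1 h)

theorem placticCon_iff {u v : FreeMonoid A} : placticCon A u v ↔ P u = P v := by
  rw [placticCon_eq_knuthCon, knuthCon_iff]

/-! ### The column `δ'` as the word of bumped letters. -/

/-- Since `y` stays in the column throughout, each inserted `a < y` bumps a letter that is at most
`y` and is not `y`. -/
theorem lt_of_mem_bumpedWord {l : List A} {δ : Finset A} {y : A} (hy : y ∈ l.foldr insertLetter δ)
    (hl : ∀ a ∈ l, a < y) : ∀ b ∈ (bumpedWord (.ofList l) δ).toList, b < y := by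
  induction l with
  | nil => simp
  | cons c l ih =>
    intro b hb
    rw [List.foldr_cons, mem_insertLetter_iff] at hy
    have hcy : c < y := hl c (by simp)
    obtain ⟨hy1, hy2⟩ := hy.resolve_left hcy.ne'
    rw [FreeMonoid.ofList_cons, bumpedWord_of_mul, FreeMonoid.toList_mul, List.mem_append] at hb
    rcases hb with hb | hb
    · obtain ⟨z, hz, -, hzy⟩ := bumped_le hy1 hcy.le
      have hz' : bumped c (act (.ofList l) δ) = some z := hz
      rw [hz', optWord_some, FreeMonoid.toList_of, List.mem_singleton] at hb
      grind
    · exact ih hy1 (fun a ha => hl a (by simp [ha])) b hb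

theorem pairwise_bumpedWord {l : List A} (hl : l.Pairwise (· > ·)) (δ : Finset A) :
    (bumpedWord (.ofList l) δ).toList.Pairwise (· > ·) := by
  induction l with
  | nil => exact List.Pairwise.nil
  | cons c l ih =>
    rw [List.pairwise_cons] at hl
    rw [FreeMonoid.ofList_cons, bumpedWord_of_mul]
    cases h : bumped c (act (.ofList l) δ) with
    | none => simpa using ih hl.2
    | some y =>
      obtain ⟨hy, hcy, -⟩ := bumped_eq_some.1 h
      simp only [optWord_some, FreeMonoid.toList_of_mul, List.pairwise_cons]
      exact ⟨lt_of_mem_bumpedWord hy fun a ha => (hl.1 a ha).trans_le hcy, ih hl.2⟩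

theorem val_insertLetter_add (x : A) (γ : Finset A) :
    (insertLetter x γ).val + ((optWord (bumped x γ)).toList : Multiset A) = {x} + γ.val := by
  cases h : bumped x γ with
  | none =>
    have hx : x ∉ γ := fun hx => lt_irrefl _ (bumped_eq_none.1 h x hx)
    simp [insertLetter_of_none h, Finset.insert_val_of_notMem hx]
  | some y =>
    obtain ⟨hy, hxy, hmin⟩ := bumped_eq_some.1 h
    have hx : x ∉ γ.erase y := by
      intro hx
      rw [Finset.mem_erase] at hx
      exact hx.1 (le_antisymm hxy (hmin x hx.2 le_rfl))
    rw [insertLetter_of_some h, Finset.insert_val_of_notMem hx, optWord_some, FreeMonoid.toList_of,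
      Finset.erase_val, ← Multiset.singleton_add, add_assoc, Multiset.coe_singleton,
      add_comm _ ({y} : Multiset A), Multiset.singleton_add y, Multiset.cons_erase hy]

theorem val_act_add (w : FreeMonoid A) (γ : Finset A) :
    (act w γ).val + ((bumpedWord w γ).toList : Multiset A) = (w.toList : Multiset A) + γ.val := by
  induction w using FreeMonoid.inductionOn' with
  | one => simp
  | of_mul x w ih =>
    rw [act_mul, bumpedWord_of_mul, FreeMonoid.toList_mul, FreeMonoid.toList_mul,
      ← Multiset.coe_add, ← Multiset.coe_add, ← add_assoc, act_of, val_insertLetter_add, add_assoc,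
      ih, add_assoc]
    simp

theorem coe_toList_word (γ : Finset A) : ((word γ).toList : Multiset A) = γ.val := by
  simp [word]

/-- Insertion conserves letters with multiplicity, so the bumped letters are those of `rest γ δ`;
being decreasing, they come in the right order. -/
theorem word_rest (γ δ : Finset A) : word (rest γ δ) = bumpedWord (word γ) δ := by
  have h := val_act_add (word γ) δ
  rw [coe_toList_word] at h
  rw [word_eq_ofList (pairwise_bumpedWord (pairwise_toList_word γ) δ)]
  · rfl
  · intro x
    rw [← Finset.mem_val]
    simp only [rest, ← h, add_tsub_cancel_left, Multiset.mem_coe]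
    rfl

theorem knuthCon_word_mul_word (γ δ : Finset A) :
    knuthCon A (word γ * word δ) (word (act (word γ) δ) * word (rest γ δ)) := by
  rw [word_rest]
  exact knuthCon_mul_word _ _

/-! ### The action is trivial on pairs `γ ≤ δ`. -/

theorem sort_le_eq_reverse (γ : Finset A) : γ.sort (· ≤ ·) = (word γ).toList.reverse := by
  refine List.Perm.eq_of_pairwise (le := (· < ·))
    (fun a b _ _ h1 h2 => absurd h1 (not_lt.2 h2.le)) (γ.sortedLT_sort).pairwise
    (List.pairwise_reverse.2 (pairwise_toList_word γ)) ?_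
  rw [List.perm_ext_iff_of_nodup (γ.sort_nodup _)
    (List.nodup_reverse.2 ((pairwise_toList_word γ).imp fun h => h.ne'))]
  simp

/-- `S` holds the letters already inserted and `ds` what is left of `δ`. The next letter bumps the
head of `ds`, or is added on top once `ds` is exhausted. -/
theorem foldl_insertLetter {as ds : List A} (has : as.Pairwise (· < ·)) (hds : ds.Pairwise (· < ·))
    (h : ∀ i (hi : i < ds.length), ∃ hi' : i < as.length, as[i] ≤ ds[i]) (S : Finset A)
    (hS : ∀ s ∈ S, ∀ a ∈ as, s < a) :
    as.foldl (fun γ x => insertLetter x γ) (S ∪ ds.toFinset) = S ∪ as.toFinset := by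
  induction as generalizing ds S with
  | nil =>
    cases ds with
    | nil => simp
    | cons d ds => simpa using h 0 (by simp)
  | cons a as ih =>
    rw [List.pairwise_cons] at has
    have hS' : ∀ s ∈ insert a S, ∀ b ∈ as, s < b := by
      intro s hs b hb
      rcases Finset.mem_insert.1 hs with rfl | hs
      · exact has.1 b hb
      · exact hS s hs b (by simp [hb])
    rw [List.foldl_cons]
    have hfin : S ∪ (a :: as).toFinset = insert a S ∪ as.toFinset := by
      ext t
      simp
    cases ds with
    | nil =>
      have hb : bumped a (S ∪ ([] : List A).toFinset) = none :=
        bumped_eq_none.2 (by simpa using fun z hz => hS z hz a (by simp))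
      rw [insertLetter_of_none hb, hfin, ← ih (ds := []) has.2 (by simp) (by simp) _ hS']
      simp
    | cons d ds =>
      rw [List.pairwise_cons] at hds
      have had : a ≤ d := (h 0 (by simp)).2
      have hSa : ∀ s ∈ S, s < a := fun s hs => hS s hs a (by simp)
      have hb : bumped a (S ∪ (d :: ds).toFinset) = some d := by
        rw [bumped_eq_some]
        refine ⟨by simp, had, fun z hz haz => ?_⟩
        have hza : z ∉ S := fun hz => (hSa z hz).not_ge haz
        rcases List.mem_cons.1 (List.mem_toFinset.1 ((Finset.mem_union.1 hz).resolve_left hza))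
          with rfl | hz
        · exact le_rfl
        · exact (hds.1 z hz).le
      have he : insertLetter a (S ∪ (d :: ds).toFinset) = insert a S ∪ ds.toFinset := by
        ext t
        simp only [mem_insertLetter_iff, hb, Finset.mem_union, Finset.mem_insert,
          List.mem_toFinset, List.mem_cons]
        have hS2 : t ∈ S → t < a := hSa t
        have hd2 : t ∈ ds → d < t := hds.1 t
        clear ih h hS hS' hfin hSa hb has hds
        grind
      rw [he, hfin]
      refine ih has.2 hds.2 (fun i hi => ?_) _ hS'
      obtain ⟨h1, h2⟩ := h (i + 1) (by simpa using hi)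
      exact ⟨by simpa using h1, h2⟩

theorem ColumnLE.act_word {γ δ : Finset A} (h : ColumnLE γ δ) : act (word γ) δ = γ := by
  obtain ⟨hc, h⟩ := h
  have h1 := foldl_insertLetter (as := γ.sort (· ≤ ·)) (ds := δ.sort (· ≤ ·))
    (γ.sortedLT_sort).pairwise (δ.sortedLT_sort).pairwise (fun i hi => ?_) ∅ (by simp)
  · rw [sort_le_eq_reverse γ, List.foldl_reverse] at h1
    simp only [Finset.sort_toFinset, Finset.empty_union, List.toFinset_reverse] at h1
    refine h1.trans ?_
    ext t
    simp
  · rw [Finset.length_sort] at hi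
    refine ⟨by simpa using hi.trans_le hc, ?_⟩
    simpa [Finset.orderEmbOfFin_apply] using h ⟨i, hi⟩

theorem ColumnLE.rest_eq {γ δ : Finset A} (h : ColumnLE γ δ) : rest γ δ = δ := by
  apply Finset.val_injective
  simp [rest, h.act_word]

/-! ### Insertion preserves tableaux. -/

/-- The number of letters of a column that are at most `t`. -/
def countLE (t : A) (γ : Finset A) : ℕ := (γ.filter (· ≤ t)).card

/-- `γ` has at least as many letters `≤ t` as `δ`, for every letter `t`. -/
def Dominates (γ δ : Finset A) : Prop := ∀ t, countLE t δ ≤ countLE t γ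

theorem Dominates.card_filter_lt {γ δ : Finset A} (h : Dominates γ δ) (y : A) :
    (δ.filter (· < y)).card ≤ (γ.filter (· < y)).card := by
  rcases (δ.filter (· < y)).eq_empty_or_nonempty with h0 | h0
  · simp [h0]
  · have hs := Finset.max'_mem _ h0
    have hle := fun z hz => Finset.le_max' (δ.filter (· < y)) z hz
    set s := (δ.filter (· < y)).max' h0
    simp only [Finset.mem_filter] at hs hle
    calc (δ.filter (· < y)).card ≤ countLE s δ := Finset.card_le_card fun z hz => by
            simp only [Finset.mem_filter] at hz ⊢
            exact ⟨hz.1, hle z hz⟩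
      _ ≤ countLE s γ := h s
      _ ≤ _ := Finset.card_le_card fun z hz => by
            simp only [Finset.mem_filter] at hz ⊢
            exact ⟨hz.1, hz.2.trans_lt hs.2⟩

/-- If the letter of `γ` at index `i` exceeded the letter `d` of `δ` there, `γ` would have at most
`i` letters `≤ d`, while `δ` has at least `i + 1`. -/
theorem Dominates.columnLE {γ δ : Finset A} (h : Dominates γ δ) : ColumnLE γ δ := by
  have hc : δ.card ≤ γ.card := by
    rcases δ.eq_empty_or_nonempty with h0 | h0
    · simp [h0]
    · calc δ.card = countLE (δ.max' h0) δ := by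
            rw [countLE, Finset.filter_true_of_mem fun z hz => δ.le_max' z hz]
        _ ≤ countLE (δ.max' h0) γ := h _
        _ ≤ γ.card := Finset.card_filter_le _ _
  refine ⟨hc, fun i => ?_⟩
  by_contra! hlt
  set d := δ.orderEmbOfFin rfl i
  have h1 : i.1 + 1 ≤ countLE d δ := by
    calc i.1 + 1 = ((Finset.Iic i).map (δ.orderEmbOfFin rfl).toEmbedding).card := by simp
      _ ≤ _ := Finset.card_le_card fun z hz => by
        simp only [Finset.mem_map, Finset.mem_Iic, RelEmbedding.coe_toEmbedding] at hz
        obtain ⟨j, hj, rfl⟩ := hz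
        simp only [Finset.mem_filter]
        exact ⟨Finset.orderEmbOfFin_mem _ _ _, (δ.orderEmbOfFin rfl).monotone hj⟩
  have h2 : countLE d γ ≤ i.1 := by
    calc countLE d γ
        ≤ ((Finset.Iio (Fin.castLE hc i)).map (γ.orderEmbOfFin rfl).toEmbedding).card :=
          Finset.card_le_card fun z hz => by
            simp only [Finset.mem_filter] at hz
            have hz1 : z ∈ Set.range (γ.orderEmbOfFin rfl) := by
              rw [Finset.range_orderEmbOfFin]
              exact hz.1
            obtain ⟨j, rfl⟩ := hz1
            simp only [Finset.mem_map, Finset.mem_Iio, RelEmbedding.coe_toEmbedding]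
            exact ⟨j, (γ.orderEmbOfFin rfl).lt_iff_lt.1 (hz.2.trans_lt hlt), rfl⟩
      _ = i.1 := by simp
  have := h d
  omega

theorem countLE_insertLetter (t x : A) (γ : Finset A) :
    countLE t γ ≤ countLE t (insertLetter x γ) := by
  cases h : bumped x γ with
  | none =>
    rw [insertLetter_of_none h]
    exact Finset.card_le_card (Finset.filter_subset_filter _ (Finset.subset_insert _ _))
  | some y =>
    obtain ⟨hy, hxy, hmin⟩ := bumped_eq_some.1 h
    rw [insertLetter_of_some h, countLE, countLE]
    by_cases hyt : y ≤ t
    · have hx : x ∉ (γ.filter (· ≤ t)).erase y := by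
        intro hx
        rw [Finset.mem_erase, Finset.mem_filter] at hx
        exact hx.1 (le_antisymm hxy (hmin x hx.2.1 le_rfl))
      rw [Finset.filter_insert, if_pos (hxy.trans hyt), Finset.filter_erase,
        Finset.card_insert_of_notMem hx, Finset.card_erase_add_one (by simp [hy, hyt])]
    · refine Finset.card_le_card fun z hz => ?_
      simp only [Finset.mem_filter, Finset.mem_insert, Finset.mem_erase] at hz ⊢
      grind

theorem Dominates.insertLetter {γ δ : Finset A} (h : Dominates γ δ) {x y : A}
    (hb : bumped x γ = some y) : Dominates (insertLetter x γ) (insertLetter y δ) := by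
  intro t
  obtain ⟨hy, hxy, hmin⟩ := bumped_eq_some.1 hb
  -- The count for `δ` can grow only if `y ≤ t` and no letter of `δ` lies in `[y, t]`. It is then at
  -- most one more than the number of letters of `δ` below `y`, and the letter `y` of `γ` makes up
  -- for that one.
  by_cases hyt : y ≤ t
  · by_cases hz : ∃ z, bumped y δ = some z ∧ z ≤ t
    · obtain ⟨z, hz, hzt⟩ := hz
      obtain ⟨hzm, hyz, -⟩ := bumped_eq_some.1 hz
      calc countLE t (Plactic.insertLetter y δ) ≤ countLE t δ := by
            rw [insertLetter_of_some hz, countLE, countLE, Finset.filter_insert, if_pos hyt,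
              Finset.filter_erase]
            refine (Finset.card_insert_le _ _).trans ?_
            rw [Finset.card_erase_add_one (by simp [hzm, hzt])]
        _ ≤ countLE t γ := h t
        _ ≤ _ := countLE_insertLetter t x γ
    · calc countLE t (Plactic.insertLetter y δ) ≤ (insert y (δ.filter (· < y))).card := by
            refine Finset.card_le_card fun s hs => ?_
            simp only [Finset.mem_filter, Finset.mem_insert, mem_insertLetter_iff] at hs ⊢
            obtain ⟨rfl | ⟨hs1, hs2⟩, hst⟩ := hs
            · simp
            · refine or_iff_not_imp_left.2 fun _ => ⟨hs1, ?_⟩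
              by_contra! hys
              obtain ⟨z, hz1, hz2, hz3⟩ := bumped_le hs1 hys
              exact hz ⟨z, hz1, hz3.trans hst⟩
        _ ≤ (δ.filter (· < y)).card + 1 := Finset.card_insert_le _ _
        _ ≤ (γ.filter (· < y)).card + 1 := by gcongr 1; exact h.card_filter_lt y
        _ = (insert y (γ.filter (· < y))).card := by
            rw [Finset.card_insert_of_notMem (by simp)]
        _ ≤ countLE t γ := Finset.card_le_card fun s hs => by
            simp only [Finset.mem_filter, Finset.mem_insert] at hs ⊢
            rcases hs with rfl | hs
            · exact ⟨hy, hyt⟩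
            · exact ⟨hs.1, hs.2.le.trans hyt⟩
        _ ≤ _ := countLE_insertLetter t x γ
  · calc countLE t (Plactic.insertLetter y δ) ≤ countLE t δ := Finset.card_le_card fun s hs => by
            simp only [Finset.mem_filter, mem_insertLetter_iff] at hs ⊢
            grind
      _ ≤ countLE t γ := h t
      _ ≤ _ := countLE_insertLetter t x γ

theorem dominates_empty (γ : Finset A) : Dominates γ ∅ := by
  intro t
  simp [countLE]

theorem isChain_insertTableau {T : List (Finset A)} (hT : T.IsChain Dominates) (x : A) :
    (insertTableau x T).IsChain Dominates := by
  induction T generalizing x with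
  | nil => simp [insertTableau]
  | cons γ T ih =>
    rw [insertTableau_cons]
    cases h : bumped x γ with
    | none =>
      cases T with
      | nil => simp
      | cons δ T =>
        rw [List.isChain_cons_cons] at hT
        simp only [optWord_none, insertWord_one, List.isChain_cons_cons]
        exact ⟨fun t => (hT.1 t).trans (countLE_insertLetter t x γ), hT.2⟩
    | some y =>
      rw [optWord_some, insertWord_of]
      have ih' := ih hT.tail y
      cases T with
      | nil =>
        simp only [insertTableau, List.isChain_cons_cons, List.isChain_singleton, and_true]
        have := (dominates_empty γ).insertLetter h
        rwa [insertLetter_of_none (γ := ∅) (bumped_eq_none.2 (by simp))] at this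
      | cons δ T =>
        rw [List.isChain_cons_cons] at hT
        rw [insertTableau_cons] at ih' ⊢
        rw [List.isChain_cons_cons]
        exact ⟨hT.1.insertLetter h, ih'⟩

theorem isChain_P (w : FreeMonoid A) : (P w).IsChain Dominates := by
  induction w using FreeMonoid.inductionOn' with
  | one => simp [P]
  | of_mul x w ih =>
    rw [P_eq_insertWord, insertWord_mul]
    exact isChain_insertTableau ih x

theorem nonempty_of_mem_insertTableau {T : List (Finset A)} (hT : ∀ γ ∈ T, γ.Nonempty) (x : A) :
    ∀ γ ∈ insertTableau x T, γ.Nonempty := by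
  induction T generalizing x with
  | nil => simp [insertTableau]
  | cons δ T ih =>
    have h1 : (insertLetter x δ).Nonempty := ⟨x, mem_insertLetter x δ⟩
    have h2 : ∀ γ ∈ T, γ.Nonempty := fun γ hγ => hT γ (by simp [hγ])
    rw [insertTableau_cons]
    intro γ hγ
    rcases List.mem_cons.1 hγ with rfl | hγ
    · exact h1
    · cases h : bumped x δ with
      | none => exact h2 γ (by simpa [h] using hγ)
      | some y => exact ih h2 y γ (by simpa [h] using hγ)

theorem nonempty_of_mem_P (w : FreeMonoid A) : ∀ γ ∈ P w, γ.Nonempty := by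
  induction w using FreeMonoid.inductionOn' with
  | one => simp [P]
  | of_mul x w ih =>
    rw [P_eq_insertWord, insertWord_mul]
    exact nonempty_of_mem_insertTableau ih x

/-! ### A tableau is recovered from its reading. -/

theorem columnLE_empty (γ : Finset A) : ColumnLE γ ∅ := (dominates_empty γ).columnLE

theorem ColumnLE.bumpedWord_word {γ δ : Finset A} (h : ColumnLE γ δ) :
    bumpedWord (word γ) δ = word δ := by
  rw [← word_rest, h.rest_eq]

theorem insertWord_nil {w : FreeMonoid A} (hw : w ≠ 1) : insertWord w [] = insertWord w [∅] := by
  obtain h | ⟨l, x, h⟩ := List.eq_nil_or_concat w.toList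
  · exact absurd (FreeMonoid.toList.injective h) hw
  · have : w = .ofList l * .of x := FreeMonoid.toList.injective (by simpa using h)
    rw [this, insertWord_mul_of_nil]

theorem word_ne_one {γ : Finset A} (h : γ.Nonempty) : word γ ≠ 1 := by
  intro h1
  obtain ⟨x, hx⟩ := h
  rw [← mem_toList_word, h1] at hx
  simp at hx

/-- `word γ` replaces the first column of `T` by `γ` and bumps exactly that column's word, so all
columns shift one place to the right. -/
theorem insertWord_word {γ : Finset A} {T : List (Finset A)} (hT : (γ :: T).IsChain ColumnLE)
    (hne : ∀ δ ∈ γ :: T, δ.Nonempty) : insertWord (word γ) T = γ :: T := by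
  induction T generalizing γ with
  | nil =>
    have h := columnLE_empty γ
    rw [insertWord_nil (word_ne_one (hne γ (by simp))), insertWord_cons, h.act_word,
      h.bumpedWord_word, word_empty, insertWord_one]
  | cons δ T ih =>
    rw [List.isChain_cons_cons] at hT
    rw [insertWord_cons, hT.1.act_word, hT.1.bumpedWord_word,
      ih hT.2 fun ε hε => hne ε (List.mem_cons_of_mem _ hε)]

theorem P_reading {T : List (Finset A)} (hT : T.IsChain ColumnLE) (hne : ∀ γ ∈ T, γ.Nonempty) :
    P (reading T) = T := by
  induction T with
  | nil => rfl
  | cons γ T ih =>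
    have ih := ih hT.tail fun δ hδ => hne δ (by simp [hδ])
    have h1 : reading (γ :: T) = word γ * reading T := by simp [reading]
    rw [h1, P_eq_insertWord, insertWord_mul, ← P_eq_insertWord, ih, insertWord_word hT hne]

/-! ### The presentation by columns. -/

variable (A) in
/-- The presented monoid of columns. -/
abbrev ColumnMonoid : Type _ := PresentedMonoid (quadraticRel A)

/-- The class of a possibly empty column. -/
def colClass (γ : Finset A) : ColumnMonoid A := PresentedMonoid.mk _ (columnWord γ)

theorem columnWord_of_nonempty (γ : Column A) : columnWord γ.1 = .of γ := by
  simp [columnWord, γ.2]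

@[simp] theorem columnWord_empty : columnWord (∅ : Finset A) = 1 := by simp [columnWord]

theorem colClass_coe (γ : Column A) : colClass γ.1 = PresentedMonoid.of _ γ := by
  rw [colClass, columnWord_of_nonempty]
  rfl

@[simp] theorem colClass_empty : colClass (∅ : Finset A) = 1 := by
  rw [colClass, columnWord_empty, map_one]

/-- Extending the relations to empty columns costs nothing, since they are trivial there, and it
avoids case distinctions on `δ'`. -/
theorem colClass_mul (γ δ : Finset A) :
    colClass γ * colClass δ = colClass (act (word γ) δ) * colClass (rest γ δ) := by
  rcases γ.eq_empty_or_nonempty with rfl | hγ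
  · have : rest ∅ δ = (∅ : Finset A) := by
      apply Finset.val_injective
      simp [rest]
    simp [this]
  · rcases δ.eq_empty_or_nonempty with rfl | hδ
    · have h := columnLE_empty γ
      rw [h.act_word, h.rest_eq]
    · have h : PresentedMonoid.mk (quadraticRel A) (.of ⟨γ, hγ⟩ * .of ⟨δ, hδ⟩) =
          PresentedMonoid.mk (quadraticRel A)
            (.of (top ⟨γ, hγ⟩ ⟨δ, hδ⟩) * columnWord (rest γ δ)) :=
        (Con.eq _).2 (ConGen.Rel.of _ _ ⟨_, _, rfl, rfl⟩)
      rw [map_mul, map_mul, ← columnWord_of_nonempty, ← columnWord_of_nonempty,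
        ← columnWord_of_nonempty] at h
      exact h

theorem colClass_mul_of_bumpedWord {γ δ ε ζ : Finset A} (h1 : act (word γ) δ = ε)
    (h2 : bumpedWord (word γ) δ = word ζ) : colClass γ * colClass δ = colClass ε * colClass ζ := by
  have h3 : rest γ δ = ζ := by
    rw [← word_rest] at h2
    ext t
    rw [← mem_toList_word, h2, mem_toList_word]
  rw [colClass_mul, h1, h3]

theorem colClass_singleton_mul_of_none {x : A} {γ : Finset A} (h : bumped x γ = none) :
    colClass {x} * colClass γ = colClass (insert x γ) := by
  rw [colClass_mul_of_bumpedWord (ε := insert x γ) (ζ := ∅), colClass_empty, mul_one]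
  · rw [word_singleton, act_of, insertLetter_of_none h]
  · simp [h]

theorem colClass_singleton_mul_of_some {x y : A} {γ : Finset A} (h : bumped x γ = some y) :
    colClass {x} * colClass γ = colClass (insert x (γ.erase y)) * colClass {y} := by
  apply colClass_mul_of_bumpedWord
  · rw [word_singleton, act_of, insertLetter_of_some h]
  · simp [h]

theorem colClass_pair {x y : A} (h : x < y) : colClass {y} * colClass {x} = colClass {x, y} := by
  rw [colClass_singleton_mul_of_none (bumped_eq_none.2 (by simpa using h)), Finset.pair_comm]

variable (A) in
/-- The morphism sending a letter to the class of the column with this letter. -/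
def letterHom : FreeMonoid A →* ColumnMonoid A := FreeMonoid.lift fun a => colClass {a}

@[simp] theorem letterHom_of (a : A) : letterHom A (.of a) = colClass {a} := by
  simp [letterHom]

/-- The two sides pass through the column relations `x · {y, z} = {x, z} · y` and `y · {x, z} = {x,
y} · z` respectively. -/
theorem letterHom_eq_of_knuthRel {u v : FreeMonoid A} (h : KnuthRel u v) :
    letterHom A u = letterHom A v := by
  cases h with
  | @left x y z hxy hyz =>
    have hb : bumped x {y, z} = some y := bumped_eq_some.2 (by simp [hxy, hyz.le])
    have he : ({y, z} : Finset A).erase y = {z} := by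
      ext t
      simp
      grind
    simp only [map_mul, letterHom_of]
    rw [mul_assoc, colClass_pair hyz, colClass_singleton_mul_of_some hb, he,
      colClass_pair (hxy.trans_lt hyz)]
  | @right x y z hxy hyz =>
    have hb : bumped y {x, z} = some z := bumped_eq_some.2 (by simp [hyz, hxy])
    have he : insert y (({x, z} : Finset A).erase z) = {x, y} := by
      ext t
      simp
      grind
    simp only [map_mul, letterHom_of]
    rw [mul_assoc (colClass {y}) (colClass {z}), colClass_pair (hxy.trans_le hyz),
      colClass_singleton_mul_of_some hb, he, colClass_pair hxy]

theorem placticCon_le_ker_letterHom : placticCon A ≤ Con.ker (letterHom A) := by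
  rw [placticCon_eq_knuthCon]
  exact Con.conGen_le.2 fun u v h => letterHom_eq_of_knuthRel h

theorem letterHom_word (γ : Finset A) : letterHom A (word γ) = colClass γ := by
  induction γ using Finset.induction_on_max with
  | empty => simp
  | insert a γ h ih =>
    rw [word_insert h, map_mul, ih, letterHom_of,
      colClass_singleton_mul_of_none (bumped_eq_none.2 h)]

variable (A) in
/-- The morphism sending a column to its decreasing word. -/
def wordHom : FreeMonoid (Column A) →* FreeMonoid A := FreeMonoid.lift fun γ => word γ.1

@[simp] theorem wordHom_of (γ : Column A) : wordHom A (.of γ) = word γ.1 := by simp [wordHom]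

theorem wordHom_columnWord (γ : Finset A) : wordHom A (columnWord γ) = word γ := by
  unfold columnWord
  split
  · simp
  · rename_i h
    rw [Finset.not_nonempty_iff_eq_empty.1 h]
    simp

theorem wordHom_ofList (T : List (Column A)) :
    wordHom A (.ofList T) = reading (T.map Subtype.val) := by
  induction T with
  | nil => rfl
  | cons γ T ih => rw [FreeMonoid.ofList_cons, map_mul, ih, wordHom_of]; rfl

theorem placticCon_wordHom_of_quadraticRel {u v : FreeMonoid (Column A)} (h : quadraticRel A u v) :
    placticCon A (wordHom A u) (wordHom A v) := by
  obtain ⟨γ, δ, rfl, rfl⟩ := h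
  rw [placticCon_eq_knuthCon, map_mul (wordHom A), map_mul (wordHom A), wordHom_columnWord,
    wordHom_of, wordHom_of, wordHom_of]
  exact knuthCon_word_mul_word γ.1 δ.1

theorem placticCon_wordHom {u v : FreeMonoid (Column A)} (h : conGen (quadraticRel A) u v) :
    placticCon A (wordHom A u) (wordHom A v) := by
  have hle : conGen (quadraticRel A) ≤ Con.comap (wordHom A) (map_mul _) (placticCon A) :=
    Con.conGen_le.2 fun u v h => placticCon_wordHom_of_quadraticRel h
  exact hle h

theorem letterHom_wordHom (u : FreeMonoid (Column A)) :
    letterHom A (wordHom A u) = PresentedMonoid.mk _ u := by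
  have : (letterHom A).comp (wordHom A) = PresentedMonoid.mk (quadraticRel A) :=
    FreeMonoid.hom_eq fun γ => by
      rw [MonoidHom.comp_apply, wordHom_of, letterHom_word, colClass_coe]
      rfl
  exact DFunLike.congr_fun this u

theorem conGen_quadraticRel_iff {u v : FreeMonoid (Column A)} :
    conGen (quadraticRel A) u v ↔ placticCon A (wordHom A u) (wordHom A v) := by
  refine ⟨placticCon_wordHom, fun h => ?_⟩
  have h1 : letterHom A (wordHom A u) = letterHom A (wordHom A v) :=
    placticCon_le_ker_letterHom h
  rw [letterHom_wordHom, letterHom_wordHom] at h1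
  exact (Con.eq _).1 h1

variable (A) in
/-- The presentation of the plactic monoid by columns. -/
def columnPresentation : ColumnMonoid A ≃* PlacticMonoid A :=
  MonoidHom.toMulEquiv
    (PresentedMonoid.lift (fun γ : Column A => (placticCon A).mk' (word γ.1)) fun u v h => by
      have h1 : FreeMonoid.lift (fun γ : Column A => (placticCon A).mk' (word γ.1)) =
          (placticCon A).mk'.comp (wordHom A) := FreeMonoid.hom_eq fun γ => by simp
      rw [h1]
      exact (Con.eq _).2 (placticCon_wordHom_of_quadraticRel h))
    ((placticCon A).lift (letterHom A) placticCon_le_ker_letterHom)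
    (PresentedMonoid.ext _ fun γ => by
      simp only [MonoidHom.comp_apply, PresentedMonoid.lift_of, Con.coe_mk', Con.lift_coe,
        MonoidHom.id_apply]
      rw [letterHom_word, colClass_coe])
    (Con.hom_ext (FreeMonoid.hom_eq fun a => by
      have h1 : colClass {a} = PresentedMonoid.of (quadraticRel A)
          ⟨{a}, Finset.singleton_nonempty a⟩ := colClass_coe ⟨{a}, Finset.singleton_nonempty a⟩
      simp only [MonoidHom.comp_apply, Con.coe_mk', Con.lift_coe, MonoidHom.id_apply,
        letterHom_of, h1, PresentedMonoid.lift_of, word_singleton]))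

theorem columnPresentation_of (γ : Column A) :
    columnPresentation A (PresentedMonoid.of _ γ) = (placticCon A).mk' (word γ.1) := by
  simp [columnPresentation]

/-! ### Confluence. -/

theorem conGen_rewritesTo {C : Type*} (R : FreeMonoid C → FreeMonoid C → Prop) :
    conGen (Rewriting.RewritesTo R) = conGen R := by
  apply le_antisymm
  · refine Con.conGen_le.2 fun u v h => ?_
    induction h with
    | rule h => exact ConGen.Rel.of _ _ h
    | refl u => exact (conGen R).refl u
    | trans _ _ h1 h2 => exact (conGen R).trans h1 h2
    | mul_left x _ h => exact (conGen R).mul ((conGen R).refl x) h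
    | mul_right x _ h => exact (conGen R).mul h ((conGen R).refl x)
  · exact Con.conGen_mono fun u v h => .rule h

theorem conGen_quadraticRule : conGen (quadraticRule A) = conGen (quadraticRel A) := by
  apply le_antisymm
  · exact Con.conGen_mono fun u v ⟨γ, δ, _, hu, hv⟩ => ⟨γ, δ, hu, hv⟩
  · refine Con.conGen_le.2 fun u v ⟨γ, δ, hu, hv⟩ => ?_
    by_cases h : ColumnLE γ.1 δ.1
    · have h1 : top γ δ = γ := Subtype.ext h.act_word
      rw [hu, hv, h1, h.rest_eq, columnWord_of_nonempty]
      exact (conGen _).refl _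
    · exact ConGen.Rel.of _ _ ⟨γ, δ, h, hu, hv⟩

/-- Left-hand sides have length two, so being reduced is a condition on adjacent columns. -/
theorem isReduced_iff {v : FreeMonoid (Column A)} :
    Rewriting.IsReduced (quadraticRule A) v ↔ (v.toList.map Subtype.val).IsChain ColumnLE := by
  rw [List.isChain_map, List.isChain_iff_forall_rel_of_append_cons_cons]
  constructor
  · intro h γ δ l₁ l₂ hl
    by_contra hle
    refine h (.ofList l₁) _ (.ofList l₂) _ ⟨γ, δ, hle, rfl, rfl⟩ ?_
    apply FreeMonoid.toList.injective
    simp [hl]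
  · rintro h x u y v' ⟨γ, δ, hle, rfl, -⟩ rfl
    exact hle (h (a := γ) (b := δ) (l₁ := x.toList) (l₂ := y.toList) (by simp))

theorem isConfluent_quadraticRule : Rewriting.IsConfluent (quadraticRule A) := by
  intro w
  simp only [conGen_rewritesTo, conGen_quadraticRule, conGen_quadraticRel_iff]
  -- A reduced word is determined by its plactic class, which gives uniqueness; existence comes from
  -- `P` of the underlying word.
  have hP : ∀ v : FreeMonoid (Column A), Rewriting.IsReduced (quadraticRule A) v →
      P (wordHom A v) = v.toList.map Subtype.val := by
    intro v hv
    rw [← FreeMonoid.ofList_toList v, wordHom_ofList]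
    exact P_reading (isReduced_iff.1 hv) (by simp +contextual)
  obtain ⟨T, hT⟩ : ∃ T : List (Column A), T.map Subtype.val = P (wordHom A w) :=
    ⟨(P (wordHom A w)).attachWith _ (nonempty_of_mem_P _), by simp⟩
  refine ⟨.ofList T, ⟨isReduced_iff.2 ?_, ?_⟩, ?_⟩
  · rw [FreeMonoid.toList_ofList, hT]
    exact (isChain_P _).imp fun _ _ h => h.columnLE
  · rw [wordHom_ofList, hT, placticCon_eq_knuthCon]
    exact knuthCon_reading_P _
  · rintro v ⟨hv, hwv⟩
    rw [placticCon_iff, hP v hv, ← hT] at hwv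
    apply FreeMonoid.toList.injective
    exact (Subtype.val_injective.list_map hwv).symm

end Plactic

theorem theorem12p5 (A : Type*) [LinearOrder A] [Finite A] :
    -- the relation `P(u) = P(v)` is a congruence, whose quotient is the plactic monoid
    (∀ u v : FreeMonoid A, Plactic.placticCon A u v ↔ Plactic.P u = Plactic.P v) ∧
    -- (i) the presentation, the generator `γ` being sent to the class of the decreasing word of `γ`
    (∃ e : PresentedMonoid (Plactic.quadraticRel A) ≃* Plactic.PlacticMonoid A,
      ∀ γ : Plactic.Column A,
        e (PresentedMonoid.of (Plactic.quadraticRel A) γ) =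
          (Plactic.placticCon A).mk' (Plactic.word γ.1)) ∧
    -- (ii) confluence
    Rewriting.IsConfluent (Plactic.quadraticRule A) :=
  ⟨fun _ _ => Plactic.placticCon_iff,
    ⟨Plactic.columnPresentation A, Plactic.columnPresentation_of⟩,
    Plactic.isConfluent_quadraticRule⟩
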